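/- Let $T\subset(0,\infty)$ be nonempty and put $T^*=T\cup\{t^{-1}:t\in T\}\cup\{1\}$. For $\gamma_-\in(0,1)$ and $\gamma_+\in(1,\infty)$ let $T_{\gamma_-,\gamma_+}$ be the set of all products $t_1\cdots t_n$ with $n\ge 1$, $t_1,\dots,t_n\in T^*$ and $\gamma_-\le t_1\cdots t_k\le\gamma_+$ for every $k=1,\dots,n$. The limit ratio of $T$ is $$R_T=\inf\Big\{\frac{\gamma_+}{\gamma_-}:\ \gamma_-\in(0,1),\ \gamma_+\in(1,\infty),\ T_{\gamma_-,\gamma_+}\text{ is dense in }[\gamma_-,\gamma_+]\Big\}\in[1,\infty],$$ with $\inf\emptyset=\infty$. Theorem 3.1. Let $T\subset(0,\infty)$ be nonempty, let $c:T\to\mathbb R$ be an arbitrary function, let $p\in\mathbb R$, and let $I\subset(0,\infty)$ be an interval (open, closed or half-open, bounded or not) with $\sup I/\inf I>R_T$, where $a/0=\infty$ for $a\in(0,\infty]$ and $\sup I/\inf I=\infty$ if $I$ is unbounded. Suppose that $\varphi:I\to\mathbb R$ satisfies $$\varphi(tx)=\varphi(x)+c(t)x^p\qquad\text{for all } t\in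 T \text{ and all } x\in I \text{ with } tx\in I,$$ and that there is an interval $U\subset I$ with more than one point such that the restriction $\varphi|_U$ is continuous. (i) If $p\ne0$, then there exist $a,b\in\mathbb R$ such that $\varphi(x)=ax^p+b$ for all $x\in I$. (ii) If $p=0$, then there exist $a,b\in\mathbb R$ such that $\varphi(x)=a\log x+b$ for all $x\in I$. -/

import Mathlib

open Set
open scoped ENNReal

namespace QDiff

/-- `T* = T ∪ T⁻¹ ∪ {1}`. -/
def starSet (T : Set ℝ) : Set ℝ :=
  T ∪ {s | ∃ t ∈ T, s = t⁻¹} ∪ {1}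

/-- The set `T_{γ₋,γ₊,n}` of all products `t₁ ⋯ tₙ` of elements of `T*` all of whose
partial products `t₁ ⋯ t_k`, `k = 1, …, n`, lie in `[γ₋, γ₊]`.
Here `t_{i+1}` is written `u i`; only `u 0, …, u (n - 1)` matter. -/
def boundedProductsOfLength (T : Set ℝ) (γm γp : ℝ) (n : ℕ) : Set ℝ :=
  {t | ∃ u : ℕ → ℝ, (∀ i < n, u i ∈ starSet T) ∧
      t = ∏ i ∈ Finset.range n, u i ∧
      ∀ k, 1 ≤ k → k ≤ n → ∏ i ∈ Finset.range k, u i ∈ Icc γm γp}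

/-- The set `T_{γ₋,γ₊}`, the union of the sets `T_{γ₋,γ₊,n}` over all `n ≥ 1`. -/
def boundedProducts (T : Set ℝ) (γm γp : ℝ) : Set ℝ :=
  {t | ∃ n : ℕ, 1 ≤ n ∧ t ∈ boundedProductsOfLength T γm γp n}

/-- The limit ratio `R_T ∈ [1, ∞]`: the infimum (with `inf ∅ = ∞`) of `γ₊ / γ₋` over all
`γ₋ ∈ (0,1)` and `γ₊ ∈ (1,∞)` such that `T_{γ₋,γ₊}` is dense in `[γ₋, γ₊]`. -/
noncomputable def limitRatio (T : Set ℝ) : ℝ≥0∞ :=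
  sInf {r | ∃ γm γp : ℝ, 0 < γm ∧ γm < 1 ∧ 1 < γp ∧
      Icc γm γp ⊆ closure (boundedProducts T γm γp) ∧
      r = ENNReal.ofReal (γp / γm)}

/-- `sup I / inf I ∈ [0, ∞]` for a nonempty set `I` of positive reals. Division in `ℝ≥0∞`
follows the convention `a / 0 = ∞` for `a ∈ (0, ∞]`; the supremum is `∞` if `I` is unbounded. -/
noncomputable def endpointRatio (I : Set ℝ) : ℝ≥0∞ :=
  sSup (ENNReal.ofReal '' I) / sInf (ENNReal.ofReal '' I)

/-- `φ` solves on `I` the simultaneous equations `φ(t x) = φ(x) + c(t) x ^ p`, `t ∈ T`,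
each of them being postulated for all `x ∈ I ∩ t⁻¹ I`, that is, `x ∈ I` with `t x ∈ I`. -/
def IsSolution (T I : Set ℝ) (c : T → ℝ) (p : ℝ) (φ : I → ℝ) : Prop :=
  ∀ (t : T) (x : I) (h : (t : ℝ) * x ∈ I), φ ⟨t * x, h⟩ = φ x + c t * (x : ℝ) ^ p

end QDiff

/-!
Extend `φ` to a function `F` on `ℝ` and choose `γ₋ < 1 < γ₊` with `γ₊ / γ₋ < sup I / inf I` for
which the bounded products are dense in `[γ₋, γ₊]`. If `[γ₋ x, γ₊ x] ⊆ I`, then the equations can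
be applied successively along every word with partial products in `[γ₋, γ₊]`; hence every bounded
product `t` satisfies `F (t * x) = F x + C * x ^ p` with `C` independent of such `x`
(`exists_increment`).

As `I` is longer than `[γ₋, γ₊]` on the logarithmic scale, every interior point of `I` can be
reached from such an `x`, and so its orbit under locally valid shifts is dense near it
(`exists_nhds_dense_orbit`). By connectedness, every open property that is invariant under local
shifts spreads from one point to the whole interior (`forall_of_locallyShiftsBy`). In particular
`F` is continuous on the interior. Passing to the limit, the equation holds for all factors
`t ∈ [γ₋, γ₊]` with a coefficient independent of the point (`shift_of_dense`). Near one point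
this forces `F = a * h + b` with `h x = x ^ p`, by comparing the two orders of applying two factors
(`local_form_of_ne_zero`), or, for `p = 0`, with `h = log`, by Cauchy's equation
(`local_form_of_eq_zero`). Having such a local representation is again an open invariant property,
so it holds everywhere in the interior; the local representations coincide because `h` is
injective (`exists_form_on_interior`).

An endpoint of `I` that belongs to `I` is moved into the interior by a suitable `t ∈ T*`, because
some letter of the words above is different from `1` and is a quotient of two points of
`[γ₋, γ₊]`; the equation for `t` then determines the value at the endpoint
(`form_of_form_on_interior`).
-/

open Filter Topology

namespace QDiff

/-! ### Shifts along bounded products -/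

lemma inv_mem_starSet {T : Set ℝ} {t : ℝ} (ht : t ∈ starSet T) : t⁻¹ ∈ starSet T := by
  rcases ht with (ht | ⟨s, hs, rfl⟩) | ht
  · exact Or.inl (Or.inr ⟨t, ht, rfl⟩)
  · exact Or.inl (Or.inl (by simpa using hs))
  · rw [mem_singleton_iff] at ht
    subst ht
    exact Or.inr (by simp)

lemma pos_of_mem_starSet {T : Set ℝ} (hT : T ⊆ Ioi 0) {t : ℝ} (ht : t ∈ starSet T) : 0 < t := by
  rcases ht with (ht | ⟨s, hs, rfl⟩) | ht
  · exact hT ht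
  · exact inv_pos.2 (hT hs)
  · rw [mem_singleton_iff] at ht
    simp [ht]

lemma boundedProducts_subset_Icc {T : Set ℝ} {γm γp : ℝ} :
    boundedProducts T γm γp ⊆ Icc γm γp := by
  rintro t ⟨n, hn, u, -, rfl, h⟩
  exact h n hn le_rfl

/-- `F` shifts by the factor `t` on `I`: the increment `F (t * x) - F x` is a constant multiple
of `x ^ p` wherever both points lie in `I`. -/
def ShiftsBy (F : ℝ → ℝ) (p : ℝ) (I : Set ℝ) (t : ℝ) : Prop :=
  ∃ C : ℝ, ∀ x ∈ I, t * x ∈ I → F (t * x) = F x + C * x ^ p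

lemma shiftsBy_inv {F : ℝ → ℝ} {p : ℝ} {I : Set ℝ} (hI : I ⊆ Ioi 0) {t : ℝ} (ht : 0 < t)
    (h : ShiftsBy F p I t) : ShiftsBy F p I t⁻¹ := by
  obtain ⟨C, hC⟩ := h
  refine ⟨-(C * t⁻¹ ^ p), fun x hx htx => ?_⟩
  have hx0 : 0 < x := hI hx
  have e : t * (t⁻¹ * x) = x := by field_simp
  have := hC (t⁻¹ * x) htx (by rwa [e])
  rw [e, Real.mul_rpow (inv_pos.2 ht).le hx0.le] at this
  linarith

/-- Steps along a word whose partial products stay in `[γ₋, γ₊]` never leave `I`, provided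
`[γ₋ x, γ₊ x] ⊆ I`, so the increments add up. -/
lemma exists_increment {F : ℝ → ℝ} {p : ℝ} {T I : Set ℝ}
    (hF : ∀ t ∈ starSet T, ShiftsBy F p I t) {γm γp : ℝ} (h0 : 0 < γm) (h1 : γm < 1)
    (h2 : 1 < γp) {t : ℝ} (ht : t ∈ boundedProducts T γm γp) :
    ∃ C : ℝ, ∀ x, 0 < x → (∀ s ∈ Icc γm γp, s * x ∈ I) → F (t * x) = F x + C * x ^ p := by
  obtain ⟨n, -, u, hu, rfl, hb⟩ := ht
  have hb' : ∀ k ≤ n, ∏ i ∈ Finset.range k, u i ∈ Icc γm γp := by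
    intro k hk
    rcases Nat.eq_zero_or_pos k with rfl | hk0
    · simp [h1.le, h2.le]
    · exact hb k hk0 hk
  suffices H : ∀ k ≤ n, ∃ C : ℝ, ∀ x, 0 < x → (∀ s ∈ Icc γm γp, s * x ∈ I) →
      F ((∏ i ∈ Finset.range k, u i) * x) = F x + C * x ^ p from H n le_rfl
  intro k
  induction k with
  | zero => exact fun _ => ⟨0, fun x _ _ => by simp⟩
  | succ k ih =>
    intro hk
    obtain ⟨C, hC⟩ := ih (by omega)
    obtain ⟨D, hD⟩ := hF (u k) (hu k (by omega))
    have hk1 := hb' k (by omega)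
    have hk2 := hb' (k + 1) hk
    refine ⟨C + D * (∏ i ∈ Finset.range k, u i) ^ p, fun x hx hs => ?_⟩
    have e : (∏ i ∈ Finset.range (k + 1), u i) * x
        = u k * ((∏ i ∈ Finset.range k, u i) * x) := by
      rw [Finset.prod_range_succ]; ring
    have := hD _ (hs _ hk1) (e ▸ hs _ hk2)
    rw [e, this, hC x hx hs, Real.mul_rpow (h0.le.trans hk1.1) hx.le]
    ring

/-- Each letter of a word is the quotient of two consecutive partial products. -/
lemma exists_small_factor {T : Set ℝ} (hT : T ⊆ Ioi 0) {γm γp : ℝ} (h0 : 0 < γm) (h1 : γm < 1)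
    (h2 : 1 < γp) (hd : Icc γm γp ⊆ closure (boundedProducts T γm γp)) :
    ∃ t ∈ starSet T, 1 < t ∧ t ≤ γp / γm := by
  have : ∃ t ∈ starSet T, t ≠ 1 ∧ t ≤ γp / γm ∧ t⁻¹ ≤ γp / γm := by
    obtain ⟨t, ht1, n, -, u, hu, rfl, hb⟩ := mem_closure_iff.1 (hd ⟨(h1.trans h2).le, le_rfl⟩)
      (Ioi 1) isOpen_Ioi h2
    have hb' : ∀ k ≤ n, ∏ i ∈ Finset.range k, u i ∈ Icc γm γp := by
      intro k hk
      rcases Nat.eq_zero_or_pos k with rfl | hk0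
      · simp [h1.le, h2.le]
      · exact hb k hk0 hk
    have : ∃ i < n, u i ≠ 1 := by
      by_contra! h
      rw [Finset.prod_eq_one (fun i hi => h i (Finset.mem_range.1 hi))] at ht1
      exact lt_irrefl (1 : ℝ) ht1
    obtain ⟨i, hi, hi1⟩ := this
    have hpos := pos_of_mem_starSet hT (hu i hi)
    have a1 := hb' i hi.le
    have a2 := hb' (i + 1) hi
    rw [Finset.prod_range_succ] at a2
    refine ⟨u i, hu i hi, hi1, ?_, ?_⟩
    · rw [le_div_iff₀ h0]
      nlinarith [a1.1, a2.2]
    · rw [inv_le_iff_one_le_mul₀ hpos, div_mul_eq_mul_div, le_div_iff₀ h0]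
      nlinarith [a1.2, a2.1]
  obtain ⟨t, ht, hne, hle, hle'⟩ := this
  rcases lt_or_gt_of_ne hne with h | h
  · exact ⟨t⁻¹, inv_mem_starSet ht, (one_lt_inv₀ (pos_of_mem_starSet hT ht)).2 h, hle'⟩
  · exact ⟨t, ht, h, hle⟩

/-! ### Orbits under local shifts -/

lemma exists_ratio_lt {I : Set ℝ} {r : ℝ} (hr : 0 < r)
    (h : ENNReal.ofReal r < endpointRatio I) : ∃ a ∈ I, ∃ b ∈ I, r * a < b := by
  by_contra! H
  refine absurd h (not_lt.2 (ENNReal.div_le_of_le_mul (sSup_le ?_)))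
  rintro _ ⟨b, hb, rfl⟩
  rw [mul_comm, ← ENNReal.div_le_iff_le_mul (Or.inl (by simpa using hr)) (Or.inl (by simp))]
  refine le_sInf ?_
  rintro _ ⟨a, ha, rfl⟩
  rw [ENNReal.div_le_iff_le_mul (Or.inl (by simpa using hr)) (Or.inl (by simp)), mul_comm,
    ← ENNReal.ofReal_mul hr.le]
  exact ENNReal.ofReal_le_ofReal (H a ha b hb)

lemma Ioo_subset_interior {I : Set ℝ} (hI : I.OrdConnected) {a b : ℝ} (ha : a ∈ I) (hb : b ∈ I) :
    Ioo a b ⊆ interior I :=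
  interior_maximal (Ioo_subset_Icc_self.trans (hI.out ha hb)) isOpen_Ioo

/-- Every interior point `x` of `I` is of the form `t * y` with `t` in a dense set of factors and
`[γ₋ y, γ₊ y]` a neighbourhood of `x` inside `I`. -/
lemma exists_base_point {I S : Set ℝ} (hI : I ⊆ Ioi 0) (hIint : I.OrdConnected)
    {γm γp : ℝ} (h0 : 0 < γm) (h1 : γm < 1) (h2 : 1 < γp) (hd : Icc γm γp ⊆ closure S)
    (hab : ∃ a ∈ I, ∃ b ∈ I, γp / γm * a < b) {x : ℝ} (hx : x ∈ interior I) :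
    ∃ t ∈ S, ∃ y, 0 < t ∧ 0 < y ∧ t * y = x ∧ γm * y < x ∧ x < γp * y ∧
      ∃ a b, a < γm * y ∧ γp * y < b ∧ Ioo a b ⊆ interior I := by
  obtain ⟨a, ha, b, hb, hab⟩ := hab
  obtain ⟨a', ha', ha'I⟩ : ∃ a' < x, a' ∈ I := by
    obtain ⟨l, hl, hl'⟩ := exists_Ioc_subset_of_mem_nhds (mem_interior_iff_mem_nhds.1 hx)
      (exists_lt x)
    exact ⟨(l + x) / 2, by linarith, hl' ⟨by linarith, by linarith⟩⟩
  obtain ⟨b', hb', hb'I⟩ : ∃ b' > x, b' ∈ I := by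
    obtain ⟨l, hl, hl'⟩ := exists_Ico_subset_of_mem_nhds (mem_interior_iff_mem_nhds.1 hx)
      (exists_gt x)
    exact ⟨(l + x) / 2, by linarith, hl' ⟨by linarith, by linarith⟩⟩
  obtain ⟨A, hA, hAx, hAa⟩ : ∃ A ∈ I, A < x ∧ A ≤ a := by
    rcases le_total a a' with h | h
    · exact ⟨a, ha, by linarith, le_rfl⟩
    · exact ⟨a', ha'I, ha', h⟩
  obtain ⟨B, hB, hBx, hBb⟩ : ∃ B ∈ I, x < B ∧ b ≤ B := by
    rcases le_total b b' with h | h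
    · exact ⟨b', hb'I, hb', h⟩
    · exact ⟨b, hb, by linarith, le_rfl⟩
  have hA0 : 0 < A := hI hA
  have hB0 : 0 < B := hI hB
  have hx0 : 0 < x := hA0.trans hAx
  have hp0 : 0 < γp := by linarith
  have hAB : γp * A < γm * B := by
    rw [div_mul_eq_mul_div, div_lt_iff₀ h0] at hab
    nlinarith
  obtain ⟨t, ⟨ht1, ht2⟩, htS⟩ : ((Ioo (max γm (γp * x / B)) (min γp (γm * x / A))) ∩ S).Nonempty := by
    have hlt : max γm (γp * x / B) < min γp (γm * x / A) := by
      refine max_lt (lt_min (by linarith) ?_) (lt_min ?_ ?_)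
      · rw [lt_div_iff₀ hA0]; nlinarith
      · rw [div_lt_iff₀ hB0]; nlinarith
      · rw [div_lt_div_iff₀ hB0 hA0]; nlinarith
    obtain ⟨s, hs⟩ := exists_between hlt
    refine mem_closure_iff.1 (hd ⟨?_, ?_⟩) _ isOpen_Ioo hs
    · exact (le_max_left _ _).trans hs.1.le
    · exact hs.2.le.trans (min_le_left _ _)
  rw [max_lt_iff, div_lt_iff₀ hB0] at ht1
  rw [lt_min_iff, lt_div_iff₀ hA0] at ht2
  have ht0 : 0 < t := h0.trans ht1.1
  refine ⟨t, htS, x / t, ht0, by positivity, by field_simp, ?_, ?_, A, B, ?_, ?_,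
    Ioo_subset_interior hIint hA hB⟩
  · rw [← mul_div_assoc, div_lt_iff₀ ht0]; nlinarith
  · rw [← mul_div_assoc, lt_div_iff₀ ht0]; nlinarith
  · rw [← mul_div_assoc, lt_div_iff₀ ht0]; nlinarith
  · rw [← mul_div_assoc, div_lt_iff₀ ht0]; nlinarith

/-- `F` shifts by the factor `r` near `x`. -/
def LocallyShiftsBy (F : ℝ → ℝ) (p r x : ℝ) : Prop :=
  ∃ C : ℝ, ∀ᶠ w in 𝓝 x, F (r * w) = F w + C * w ^ p

/-- If every factor in a dense subset of `[γ₋, γ₊]` shifts `F` at points `y` with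
`[γ₋ y, γ₊ y] ⊆ I`, then the orbit of an interior point of `I` under local shifts is dense near
that point. -/
lemma exists_nhds_dense_orbit {I S : Set ℝ} {F : ℝ → ℝ} {p : ℝ} (hI : I ⊆ Ioi 0)
    (hIint : I.OrdConnected)
    {γm γp : ℝ} (h0 : 0 < γm) (h1 : γm < 1) (h2 : 1 < γp) (hd : Icc γm γp ⊆ closure S)
    (hS : ∀ t ∈ S, ∃ C : ℝ, ∀ x, 0 < x → (∀ s ∈ Icc γm γp, s * x ∈ I) →
      F (t * x) = F x + C * x ^ p)
    (hab : ∃ a ∈ I, ∃ b ∈ I, γp / γm * a < b) {x : ℝ} (hx : x ∈ interior I) :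
    ∃ l u, x ∈ Ioo l u ∧ ∀ V : Set ℝ, IsOpen V → (V ∩ Ioo l u).Nonempty →
      ∃ r, 0 < r ∧ r * x ∈ V ∧ LocallyShiftsBy F p r x := by
  obtain ⟨t, htS, y, ht0, hy0, rfl, hl, hu, a, b, ha, hb, hab'⟩ :=
    exists_base_point hI hIint h0 h1 h2 hd hab hx
  refine ⟨γm * y, γp * y, ⟨hl, hu⟩, fun V hV ⟨v, hvV, hv⟩ => ?_⟩
  have hvy : v / y ∈ Icc γm γp :=
    ⟨((lt_div_iff₀ hy0).2 hv.1).le, ((div_lt_iff₀ hy0).2 hv.2).le⟩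
  obtain ⟨s, ⟨hsV, hs0⟩, hsS⟩ := mem_closure_iff.1 (hd hvy)
    ({s | s * y ∈ V} ∩ Ioi 0) ((hV.preimage (by fun_prop : Continuous fun s : ℝ => s * y)).inter
      isOpen_Ioi) ⟨by simpa [div_mul_cancel₀ _ hy0.ne'] using hvV, h0.trans_le hvy.1⟩
  obtain ⟨C, hC⟩ := hS s hsS
  obtain ⟨D, hD⟩ := hS t htS
  have hs0 : 0 < s := hs0
  refine ⟨s / t, by positivity, ?_, (C - D) * (t⁻¹) ^ p, ?_⟩
  · have : s / t * (t * y) = s * y := by field_simp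
    rw [this]; exact hsV
  have hev : ∀ᶠ z in 𝓝 y, 0 < z ∧ ∀ s ∈ Icc γm γp, s * z ∈ I := by
    have e1 : ∀ᶠ z in 𝓝 y, a < γm * z :=
      (by fun_prop : Continuous fun z : ℝ => γm * z).continuousAt.eventually (lt_mem_nhds ha)
    have e2 : ∀ᶠ z in 𝓝 y, γp * z < b :=
      (by fun_prop : Continuous fun z : ℝ => γp * z).continuousAt.eventually (gt_mem_nhds hb)
    filter_upwards [e1, e2, lt_mem_nhds hy0] with z z1 z2 z0
    refine ⟨z0, fun s hs => interior_subset (hab' ⟨?_, ?_⟩)⟩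
    · exact z1.trans_le (by gcongr; exact hs.1)
    · exact lt_of_le_of_lt (by gcongr; exact hs.2) z2
  have hcont : Tendsto (fun w : ℝ => w / t) (𝓝 (t * y)) (𝓝 y) := by
    have := (by fun_prop : Continuous fun w : ℝ => w / t).tendsto (t * y)
    rwa [mul_div_cancel_left₀ _ ht0.ne'] at this
  filter_upwards [hcont.eventually hev, lt_mem_nhds (mul_pos ht0 hy0)] with w ⟨hw0, hw⟩ hwpos
  have f1 := hC _ hw0 hw
  have f2 := hD _ hw0 hw
  have e1 : t * (w / t) = w := by field_simp
  have e2 : s * (w / t) = s / t * w := by ring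
  rw [e1] at f2
  rw [e2] at f1
  rw [f1, f2, div_eq_inv_mul, Real.mul_rpow (inv_pos.2 ht0).le hwpos.le]
  ring

/-- An open property which is invariant under local shifts and holds at one interior point holds
at all of them: local density of the orbits makes the set of points with the property relatively
closed in the connected set `interior I`. -/
lemma forall_of_locallyShiftsBy {I : Set ℝ} {F : ℝ → ℝ} {p : ℝ} (hIint : I.OrdConnected)
    (horb : ∀ x ∈ interior I, ∃ l u, x ∈ Ioo l u ∧ ∀ V : Set ℝ, IsOpen V → (V ∩ Ioo l u).Nonempty →
      ∃ r, 0 < r ∧ r * x ∈ V ∧ LocallyShiftsBy F p r x)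
    {P : ℝ → Prop} (hopen : ∀ x, P x → ∀ᶠ y in 𝓝 x, P y)
    (hinv : ∀ x ∈ interior I, ∀ r, 0 < r → LocallyShiftsBy F p r x → P (r * x) → P x)
    {x₀ : ℝ} (hx₀ : x₀ ∈ interior I) (hP : P x₀) : ∀ x ∈ interior I, P x := by
  have hPo : IsOpen {x | P x} := isOpen_iff_mem_nhds.2 fun x hx => hopen x hx
  have hconn : IsPreconnected (interior I) := hIint.convex.interior.isPreconnected
  refine hconn.subset_of_closure_inter_subset hPo ⟨x₀, hx₀, hP⟩ ?_
  rintro x ⟨hxc, hx⟩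
  obtain ⟨l, u, hxlu, h⟩ := horb x hx
  have := mem_closure_iff.1 hxc _ isOpen_Ioo hxlu
  obtain ⟨r, hr, hrP, hrx⟩ := h {x | P x} hPo (by rwa [inter_comm])
  exact hinv x hx r hr hrx hrP

/-! ### Local form of the solutions -/

/-- A bounded solution of Cauchy's equation near `0` is linear near `0`: after subtracting the
linear function that agrees at `d`, halving the argument and reducing modulo `d` show that
any bound `M` can be replaced by `M / 2`. -/
lemma linear_of_additive_of_bounded {f : ℝ → ℝ} {d B : ℝ} (hd : 0 < d)
    (hadd : ∀ x ∈ Icc (-d) d, ∀ y ∈ Icc (-d) d, x + y ∈ Icc (-d) d → f (x + y) = f x + f y)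
    (hB : ∀ x ∈ Icc (-d) d, |f x| ≤ B) :
    ∀ x ∈ Icc (-d) d, f x = f d / d * x := by
  set g : ℝ → ℝ := fun x => f x - f d / d * x with hg
  have gd : g d = 0 := by simp [hg, hd.ne']
  have gadd : ∀ x ∈ Icc (-d) d, ∀ y ∈ Icc (-d) d, x + y ∈ Icc (-d) d →
      g (x + y) = g x + g y := by
    intro x hx y hy hxy
    simp only [hg, hadd x hx y hy hxy]; ring
  have gB : ∀ x ∈ Icc (-d) d, |g x| ≤ B + |f d / d| * d := by
    intro x hx
    refine (abs_sub _ _).trans (add_le_add (hB x hx) ?_)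
    rw [abs_mul]
    gcongr
    exact abs_le.2 hx
  have step : ∀ M, (∀ x ∈ Icc (-d) d, |g x| ≤ M) → ∀ x ∈ Icc (-d) d, |g x| ≤ M / 2 := by
    intro M hM
    have half : ∀ x ∈ Icc (-(d / 2)) (d / 2), |g x| ≤ M / 2 := by
      intro x hx
      have hx' : x ∈ Icc (-d) d := ⟨by linarith [hx.1], by linarith [hx.2]⟩
      have h2 : x + x ∈ Icc (-d) d := ⟨by linarith [hx.1], by linarith [hx.2]⟩
      have := hM _ h2
      rw [gadd x hx' x hx' h2, ← two_mul, abs_mul, abs_two] at this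
      linarith
    intro x hx
    rcases le_total x (d / 2) with h1 | h1
    · rcases le_total (-(d / 2)) x with h2 | h2
      · exact half x ⟨h2, h1⟩
      · have := gadd x hx d ⟨by linarith, le_rfl⟩ ⟨by linarith [hx.1], by linarith⟩
        rw [gd, add_zero] at this
        rw [← this]
        exact half _ ⟨by linarith [hx.1], by linarith⟩
    · have := gadd (x - d) ⟨by linarith, by linarith [hx.2]⟩ d ⟨by linarith, le_rfl⟩
        (by simpa using hx)
      rw [gd, add_zero, sub_add_cancel] at this
      rw [this]
      exact half _ ⟨by linarith [hx.1], by linarith [hx.2]⟩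
  intro x hx
  have key : ∀ n : ℕ, ∀ x ∈ Icc (-d) d, |g x| ≤ (B + |f d / d| * d) / 2 ^ n := by
    intro n
    induction n with
    | zero => simpa using gB
    | succ n ih =>
      intro x hx
      have := step _ ih x hx
      rwa [div_div, ← pow_succ] at this
  have lim : Tendsto (fun n : ℕ => (B + |f d / d| * d) / 2 ^ n) atTop (𝓝 0) :=
    tendsto_const_nhds.div_atTop (tendsto_pow_atTop_atTop_of_one_lt one_lt_two)
  have h0 : |g x| ≤ 0 := ge_of_tendsto' lim fun n => key n x hx
  have : g x = 0 := abs_nonpos_iff.1 h0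
  simp only [hg] at this
  linarith

/-- By continuity the shift equation extends from a dense set of factors to all factors in
`[γ₋, γ₊]`, with a coefficient that does not depend on the point. -/
lemma shift_of_dense {S I : Set ℝ} {F : ℝ → ℝ} {p γm γp : ℝ} (hSsub : S ⊆ Icc γm γp)
    (hd : Icc γm γp ⊆ closure S)
    (hS : ∀ t ∈ S, ∃ C : ℝ, ∀ x, 0 < x → (∀ s ∈ Icc γm γp, s * x ∈ I) →
      F (t * x) = F x + C * x ^ p)
    (hF : ∀ x ∈ interior I, ContinuousAt F x)
    {x y : ℝ} (hx : 0 < x) (hxI : ∀ s ∈ Icc γm γp, s * x ∈ interior I)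
    (hy : 0 < y) (hyI : ∀ s ∈ Icc γm γp, s * y ∈ interior I) {t : ℝ} (ht : t ∈ Icc γm γp) :
    F (t * x) = F x + (F (t * y) - F y) / y ^ p * x ^ p := by
  have hc : ∀ x, (∀ s ∈ Icc γm γp, s * x ∈ interior I) →
      ContinuousOn (fun t => F (t * x)) (Icc γm γp) := by
    intro x hxI s hs
    exact (ContinuousAt.comp (f := fun t : ℝ => t * x) (hF _ (hxI s hs))
      (by fun_prop)).continuousWithinAt
  have he : EqOn (fun t => F (t * x)) (fun t => F x + (F (t * y) - F y) / y ^ p * x ^ p) S := by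
    intro s hs
    obtain ⟨C, hC⟩ := hS s hs
    have := (Real.rpow_pos_of_pos hy p).ne'
    simp only
    rw [hC x hx fun s hs => interior_subset (hxI s hs),
      hC y hy fun s hs => interior_subset (hyI s hs)]
    field_simp
    ring
  have hyc := hc y hyI
  exact he.of_subset_closure (hc x hxI)
    (continuousOn_const.add (((hyc.sub continuousOn_const).div_const _).mul continuousOn_const))
    hSsub hd ht

/-- The case `p ≠ 0` of the local form: evaluating `G (y + z)` in both orders shows that the
coefficient `E y` is proportional to `exp (y * p) - 1`. No regularity is needed. -/
lemma local_form_of_ne_zero {G E : ℝ → ℝ} {p d q : ℝ} (hp : p ≠ 0) (hd : 0 < d) (hq : 0 < q)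
    (hG : ∀ y ∈ Icc (-d) d, ∀ z ∈ Icc (-d) d, G (y + z) = G z + E y * (Real.exp z * q) ^ p) :
    ∃ a b, ∀ y ∈ Icc (-d) d, G y = a * (Real.exp y * q) ^ p + b := by
  have h0 : (0 : ℝ) ∈ Icc (-d) d := ⟨by linarith, hd.le⟩
  have hdd : d ∈ Icc (-d) d := ⟨by linarith, le_rfl⟩
  have hexp : ∀ y, (Real.exp y * q) ^ p = Real.exp (y * p) * q ^ p := fun y => by
    rw [Real.mul_rpow (Real.exp_pos _).le hq.le, ← Real.exp_mul]
  have hqp := Real.rpow_pos_of_pos hq p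
  simp only [hexp] at hG ⊢
  have hne : Real.exp (d * p) - 1 ≠ 0 := by
    rw [sub_ne_zero, Ne, Real.exp_eq_one_iff]
    exact mul_ne_zero hd.ne' hp
  refine ⟨E d / (Real.exp (d * p) - 1), G 0 - E d / (Real.exp (d * p) - 1) * q ^ p,
    fun y hy => ?_⟩
  have e1 := hG y hy 0 h0
  have e2 := hG d hdd 0 h0
  have e3 := hG y hy d hdd
  have e4 := hG d hdd y hy
  simp only [zero_mul, Real.exp_zero, one_mul, add_zero] at e1 e2
  rw [add_comm d y, e1, e3, e2] at e4
  have e5 : E y * (Real.exp (d * p) - 1) = E d * (Real.exp (y * p) - 1) := by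
    refine mul_right_cancel₀ hqp.ne' ?_
    linarith
  have e6 : E y = E d / (Real.exp (d * p) - 1) * (Real.exp (y * p) - 1) := by
    rw [div_mul_eq_mul_div, eq_div_iff hne, e5]
  rw [e1, e6]
  ring

lemma local_form_of_eq_zero {G E : ℝ → ℝ} {d : ℝ} (hd : 0 < d)
    (hG : ∀ y ∈ Icc (-d) d, ∀ z ∈ Icc (-d) d, G (y + z) = G z + E y)
    (hc : ContinuousOn G (Icc (-d) d)) :
    ∃ a b, ∀ y ∈ Icc (-d) d, G y = a * y + b := by
  have h0 : (0 : ℝ) ∈ Icc (-d) d := ⟨by linarith, hd.le⟩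
  have hE : ∀ y ∈ Icc (-d) d, E y = G y - G 0 := fun y hy => by
    have := hG y hy 0 h0
    rw [add_zero] at this
    linarith
  obtain ⟨B, hB⟩ := isCompact_Icc.exists_bound_of_continuousOn (hc.sub continuousOn_const)
  have hlin := linear_of_additive_of_bounded (f := fun y => G y - G 0) hd
    (fun x hx y hy _ => by
      rw [hG x hx y hy, hE x hx]
      ring) hB
  refine ⟨(G d - G 0) / d, G 0, fun y hy => ?_⟩
  rw [← hlin y hy]
  ring

/-- The local form at a base point: the shift equation with coefficients independent of the point,
written in the variable `y = log (x / x₀)`. -/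
lemma exists_local_form {S I : Set ℝ} {F : ℝ → ℝ} {p γm γp : ℝ} (h1 : γm < 1)
    (h2 : 1 < γp) (hSsub : S ⊆ Icc γm γp) (hd : Icc γm γp ⊆ closure S)
    (hS : ∀ t ∈ S, ∃ C : ℝ, ∀ x, 0 < x → (∀ s ∈ Icc γm γp, s * x ∈ I) →
      F (t * x) = F x + C * x ^ p)
    (hF : ∀ x ∈ interior I, ContinuousAt F x) {q a b : ℝ} (hq : 0 < q)
    (ha : a < γm * q) (hb : γp * q < b) (hab : Ioo a b ⊆ interior I) :
    (p ≠ 0 → ∃ a b, ∀ᶠ x in 𝓝 q, F x = a * x ^ p + b) ∧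
    (p = 0 → ∃ a b, ∀ᶠ x in 𝓝 q, F x = a * Real.log x + b) := by
  have hK : ∀ᶠ y in 𝓝 (0 : ℝ), Real.exp y ∈ Icc γm γp ∧
      ∀ s ∈ Icc γm γp, s * (Real.exp y * q) ∈ interior I := by
    have c : Tendsto Real.exp (𝓝 0) (𝓝 1) := by simpa using Real.continuous_exp.tendsto 0
    have c1 : Tendsto (fun y => γm * (Real.exp y * q)) (𝓝 0) (𝓝 (γm * q)) := by
      simpa using Tendsto.const_mul γm (Tendsto.mul_const q c)
    have c2 : Tendsto (fun y => γp * (Real.exp y * q)) (𝓝 0) (𝓝 (γp * q)) := by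
      simpa using Tendsto.const_mul γp (Tendsto.mul_const q c)
    filter_upwards [c.eventually (Icc_mem_nhds h1 h2), c1.eventually (lt_mem_nhds ha),
      c2.eventually (gt_mem_nhds hb)] with y y1 y2 y3
    have := Real.exp_pos y
    refine ⟨y1, fun s hs => hab ⟨y2.trans_le ?_, lt_of_le_of_lt ?_ y3⟩⟩
    · gcongr
      exact hs.1
    · gcongr
      exact hs.2
  obtain ⟨ε, hε, hK⟩ := Metric.eventually_nhds_iff.1 hK
  obtain ⟨d, hd0, hdε⟩ := exists_between hε
  have hK : ∀ y ∈ Icc (-d) d, Real.exp y ∈ Icc γm γp ∧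
      ∀ s ∈ Icc γm γp, s * (Real.exp y * q) ∈ interior I := fun y hy => hK (by
    rw [Real.dist_eq, sub_zero]
    exact (abs_le.2 hy).trans_lt hdε)
  have hK0 := hK 0 ⟨by linarith, hd0.le⟩
  simp only [Real.exp_zero, one_mul] at hK0
  have hG : ∀ y ∈ Icc (-d) d, ∀ z ∈ Icc (-d) d, F (Real.exp (y + z) * q) = F (Real.exp z * q) +
      (F (Real.exp y * q) - F q) / q ^ p * (Real.exp z * q) ^ p := by
    intro y hy z hz
    rw [Real.exp_add, mul_assoc]
    exact shift_of_dense hSsub hd hS hF (mul_pos (Real.exp_pos z) hq) (hK z hz).2 hq hK0.2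
      (hK y hy).1
  have hlog : Tendsto (fun x => Real.log x - Real.log q) (𝓝 q) (𝓝 0) := by
    simpa using (Real.continuousAt_log hq.ne').tendsto.sub_const (Real.log q)
  have hev : ∀ᶠ x in 𝓝 q, ∃ y ∈ Icc (-d) d, x = Real.exp y * q ∧ y = Real.log x - Real.log q := by
    filter_upwards [hlog.eventually (Icc_mem_nhds (neg_lt_zero.2 hd0) hd0), lt_mem_nhds hq]
      with x hx hx0
    refine ⟨_, hx, ?_, rfl⟩
    rw [Real.exp_sub, Real.exp_log hx0, Real.exp_log hq, div_mul_cancel₀ _ hq.ne']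
  constructor
  · intro hp
    obtain ⟨a, b, h⟩ := local_form_of_ne_zero (G := fun y => F (Real.exp y * q)) hp hd0 hq hG
    refine ⟨a, b, ?_⟩
    filter_upwards [hev] with x ⟨y, hy, hxy, _⟩
    rw [hxy]
    exact h y hy
  · rintro rfl
    have hc : ContinuousOn (fun y => F (Real.exp y * q)) (Icc (-d) d) := by
      intro y hy
      have hy1 := (hK y hy).2 1 ⟨h1.le, h2.le⟩
      rw [one_mul] at hy1
      exact (ContinuousAt.comp (f := fun y => Real.exp y * q) (hF _ hy1)
        (by fun_prop)).continuousWithinAt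
    simp only [Real.rpow_zero, mul_one] at hG
    obtain ⟨a, b, h⟩ := local_form_of_eq_zero (G := fun y => F (Real.exp y * q)) hd0 hG hc
    refine ⟨a, b - a * Real.log q, ?_⟩
    filter_upwards [hev] with x ⟨y, hy, hxy, hyl⟩
    have := h y hy
    simp only [← hxy] at this
    rw [this, hyl]
    ring

/-! ### Gluing and endpoints -/

/-- Local representations by `a * h + b` with `h` injective glue to one on the interior of an
interval, since the coefficients are determined by the values at two points. -/
lemma exists_form_on_interior {I : Set ℝ} {F h : ℝ → ℝ} (hI : I ⊆ Ioi 0)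
    (hIint : I.OrdConnected) (hinj : InjOn h (Ioi 0)) {x₀ a b : ℝ} (hx₀ : x₀ ∈ interior I)
    (hab : ∀ᶠ y in 𝓝 x₀, F y = a * h y + b)
    (hloc : ∀ x ∈ interior I, ∃ a b, ∀ᶠ y in 𝓝 x, F y = a * h y + b) :
    ∀ x ∈ interior I, F x = a * h x + b := by
  have hsub : interior I ⊆ {x | ∀ᶠ y in 𝓝 x, F y = a * h y + b} := by
    refine (hIint.convex.interior.isPreconnected).subset_of_closure_inter_subset
      (isOpen_iff_mem_nhds.2 fun x hx => eventually_eventually_nhds.2 hx) ⟨x₀, hx₀, hab⟩ ?_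
    rintro x ⟨hxc, hx⟩
    obtain ⟨a', b', h'⟩ := hloc x hx
    have hpos : ∀ᶠ y in 𝓝 x, 0 < y := lt_mem_nhds (hI (interior_subset hx))
    obtain ⟨z, hz, hz'⟩ := mem_closure_iff_nhds.1 hxc _
      (eventually_eventually_nhds.2 (h'.and hpos))
    have hall := hz.and hz'
    obtain ⟨w, ⟨⟨w1, w2⟩, w3⟩, hw⟩ :=
      ((hall.filter_mono nhdsWithin_le_nhds).and (eventually_mem_nhdsWithin (s := {z}ᶜ))).exists
    obtain ⟨⟨z1, z2⟩, z3⟩ := hall.self_of_nhds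
    have hne : h w - h z ≠ 0 := sub_ne_zero.2 fun e => hw (hinj w2 z2 e)
    have ha : a' = a := by
      refine mul_right_cancel₀ hne ?_
      linarith
    have hb : b' = b := by
      subst ha
      linarith
    rw [ha, hb] at h'
    exact h'
  exact fun x hx => (hsub hx).self_of_nhds

/-- A representation by `a * h + b` on the interior extends to an endpoint that a factor `t ∈ T*`
moves into the interior; `h` satisfies the same kind of shift equation as `F`. -/
lemma form_of_form_on_interior {I : Set ℝ} {F h κ : ℝ → ℝ} {p a b t : ℝ} (hI : I ⊆ Ioi 0)
    (hIint : I.OrdConnected) (hh : ∀ r w, 0 < r → 0 < w → h (r * w) = h w + κ r * w ^ p)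
    (hform : ∀ x ∈ interior I, F x = a * h x + b) {x : ℝ} (hx : x ∈ I) (ht : 0 < t)
    (hshift : ShiftsBy F p I t) (htx : t * x ∈ interior I) : F x = a * h x + b := by
  obtain ⟨C, hC⟩ := hshift
  have hcl : x ∈ closure (interior I) := by
    rw [(hIint.convex : Convex ℝ I).closure_interior_eq_closure_of_nonempty_interior ⟨_, htx⟩]
    exact subset_closure hx
  obtain ⟨z, hz1, hz2⟩ := mem_closure_iff.1 hcl {z | t * z ∈ interior I}
    (isOpen_interior.preimage (by fun_prop : Continuous fun z : ℝ => t * z)) htx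
  have hz0 : 0 < z := hI (interior_subset hz2)
  have e1 := hC z (interior_subset hz2) (interior_subset hz1)
  rw [hform _ hz1, hform _ hz2, hh t z ht hz0] at e1
  have hCκ : a * κ t = C := by
    refine mul_right_cancel₀ (Real.rpow_pos_of_pos hz0 p).ne' ?_
    linarith
  have e2 := hC x hx (interior_subset htx)
  rw [hform _ htx, hh t x ht (hI hx), ← hCκ] at e2
  linarith

/-- A point of `I` that is not interior lies to one side of both `a` and `b`, and a factor of size at
most `r` moves it strictly towards the other side without leaving `I`. -/
lemma exists_factor_mem_interior {I T : Set ℝ} (hI : I ⊆ Ioi 0) (hIint : I.OrdConnected)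
    {t r : ℝ} (ht : t ∈ starSet T) (ht1 : 1 < t) (htr : t ≤ r)
    (hab : ∃ a ∈ I, ∃ b ∈ I, r * a < b) {x : ℝ} (hx : x ∈ I) :
    ∃ s ∈ starSet T, s * x ∈ interior I := by
  obtain ⟨a, ha, b, hb, hab⟩ := hab
  have ha0 : 0 < a := hI ha
  have hx0 : 0 < x := hI hx
  have htab : t * a < b := lt_of_le_of_lt (by gcongr) hab
  have htpos : 0 < t := by linarith
  rcases le_or_gt x a with hxa | hxa
  · exact ⟨t, ht, Ioo_subset_interior hIint hx hb ⟨by nlinarith, by nlinarith⟩⟩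
  rcases lt_or_ge x b with hxb | hxb
  · exact ⟨1, Or.inr rfl, by
      rw [one_mul]
      exact Ioo_subset_interior hIint ha hb ⟨hxa, hxb⟩⟩
  · refine ⟨t⁻¹, inv_mem_starSet ht, Ioo_subset_interior hIint ha hx ⟨?_, ?_⟩⟩
    · rw [← div_eq_inv_mul, lt_div_iff₀ htpos]
      linarith
    · rw [← div_eq_inv_mul, div_lt_iff₀ htpos]
      nlinarith

lemma tendsto_mul_left_nhds (r x : ℝ) : Tendsto (fun w => r * w) (𝓝 x) (𝓝 (r * x)) :=
  (by fun_prop : Continuous fun w : ℝ => r * w).tendsto x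

lemma eventually_continuousAt_of_locallyShiftsBy {F : ℝ → ℝ} {p r x : ℝ} (hx : 0 < x)
    (h : LocallyShiftsBy F p r x) (hF : ∀ᶠ y in 𝓝 (r * x), ContinuousAt F y) :
    ∀ᶠ y in 𝓝 x, ContinuousAt F y := by
  obtain ⟨C, hC⟩ := h
  filter_upwards [(tendsto_mul_left_nhds r x).eventually hF, eventually_eventually_nhds.2 hC,
    lt_mem_nhds hx] with y hy1 hy2 hy0
  have hc : ContinuousAt (fun w => F (r * w) - C * w ^ p) y :=
    (ContinuousAt.comp (f := fun w : ℝ => r * w) hy1 (by fun_prop)).sub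
      (continuousAt_const.mul (Real.continuousAt_rpow_const y p (Or.inl hy0.ne')))
  refine hc.congr ?_
  filter_upwards [hy2] with w hw
  rw [hw]
  ring

/-- A family `a * h + b` which contains `x ^ p` and satisfies the shift equations is preserved by
local shifts. -/
lemma exists_form_of_locallyShiftsBy {F h κ : ℝ → ℝ} {p r x m n : ℝ} (hr : 0 < r) (hx : 0 < x)
    (hh : ∀ r w, 0 < r → 0 < w → h (r * w) = h w + κ r * w ^ p)
    (hp : ∀ w, 0 < w → w ^ p = m * h w + n) (hF : LocallyShiftsBy F p r x)
    (hform : ∃ a b, ∀ᶠ y in 𝓝 (r * x), F y = a * h y + b) :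
    ∃ a b, ∀ᶠ y in 𝓝 x, F y = a * h y + b := by
  obtain ⟨C, hC⟩ := hF
  obtain ⟨a, b, hab⟩ := hform
  refine ⟨a + (a * κ r - C) * m, b + (a * κ r - C) * n, ?_⟩
  filter_upwards [(tendsto_mul_left_nhds r x).eventually hab, hC, lt_mem_nhds hx] with y h1 h2 h3
  rw [hh r y hr h3, h2, hp y h3] at h1
  linear_combination h1

/-- The conclusion for a single family `a * h + b`, from one local representation. -/
lemma exists_form {I T : Set ℝ} {F h κ : ℝ → ℝ} {p m n x₀ : ℝ} (hI : I ⊆ Ioi 0)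
    (hIint : I.OrdConnected) (hT : T ⊆ Ioi 0) (hF : ∀ t ∈ starSet T, ShiftsBy F p I t)
    (hmove : ∀ x ∈ I, ∃ s ∈ starSet T, s * x ∈ interior I)
    (horb : ∀ x ∈ interior I, ∃ l u, x ∈ Ioo l u ∧ ∀ V : Set ℝ, IsOpen V → (V ∩ Ioo l u).Nonempty →
      ∃ r, 0 < r ∧ r * x ∈ V ∧ LocallyShiftsBy F p r x)
    (hinj : InjOn h (Ioi 0)) (hh : ∀ r w, 0 < r → 0 < w → h (r * w) = h w + κ r * w ^ p)
    (hp : ∀ w, 0 < w → w ^ p = m * h w + n) (hx₀ : x₀ ∈ interior I)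
    (hloc : ∃ a b, ∀ᶠ y in 𝓝 x₀, F y = a * h y + b) :
    ∃ a b, ∀ x ∈ I, F x = a * h x + b := by
  have hall := forall_of_locallyShiftsBy (P := fun x => ∃ a b, ∀ᶠ y in 𝓝 x, F y = a * h y + b)
    hIint horb
    (fun x ⟨a, b, hab⟩ => (eventually_eventually_nhds.2 hab).mono fun y hy => ⟨a, b, hy⟩)
    (fun x hx r hr hs hP =>
      exists_form_of_locallyShiftsBy hr (hI (interior_subset hx)) hh hp hs hP) hx₀ hloc
  obtain ⟨a, b, hab⟩ := hloc
  refine ⟨a, b, fun x hx => ?_⟩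
  obtain ⟨s, hs, hsx⟩ := hmove x hx
  exact form_of_form_on_interior hI hIint hh
    (exists_form_on_interior hI hIint hinj hx₀ hab hall) hx (pos_of_mem_starSet hT hs)
    (hF s hs) hsx

end QDiff

/-! ### The solutions on `I` -/

theorem theorem3p1 (T : Set ℝ) (hT : T ⊆ Set.Ioi 0) (hTne : T.Nonempty)
    (c : T → ℝ) (p : ℝ)
    (I : Set ℝ) (hI : I ⊆ Set.Ioi 0) (hIint : I.OrdConnected)
    (hratio : QDiff.limitRatio T < QDiff.endpointRatio I)
    (φ : I → ℝ) (hφ : QDiff.IsSolution T I c p φ)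
    (hcont : ∃ U : Set ℝ, U ⊆ I ∧ U.OrdConnected ∧ U.Nontrivial ∧
      ContinuousOn φ {x : I | (x : ℝ) ∈ U}) :
    (p ≠ 0 → ∃ a b : ℝ, ∀ x : I, φ x = a * (x : ℝ) ^ p + b) ∧
    (p = 0 → ∃ a b : ℝ, ∀ x : I, φ x = a * Real.log x + b) := by
  classical
  obtain ⟨_, ⟨γm, γp, h0, h1, h2, hd, rfl⟩, hlt⟩ := sInf_lt_iff.1 hratio
  have hr0 : 0 < γp / γm := div_pos (by linarith) h0
  have hab := QDiff.exists_ratio_lt hr0 hlt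
  -- `0` is a dummy value: the values of `F` outside `I` are irrelevant.
  obtain ⟨F, hFφ⟩ : ∃ F : ℝ → ℝ, ∀ x : I, F x = φ x :=
    ⟨fun x => if h : x ∈ I then φ ⟨x, h⟩ else 0, fun x => by simp⟩
  have hFT : ∀ t ∈ T, QDiff.ShiftsBy F p I t := fun t ht => ⟨c ⟨t, ht⟩, fun x hx htx => by
    have := hφ ⟨t, ht⟩ ⟨x, hx⟩ htx
    rw [← hFφ, ← hFφ] at this
    exact this⟩
  have hF : ∀ t ∈ QDiff.starSet T, QDiff.ShiftsBy F p I t := by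
    rintro t ((ht | ⟨s, hs, rfl⟩) | ht)
    · exact hFT t ht
    · exact QDiff.shiftsBy_inv hI (hT hs) (hFT s hs)
    · rw [mem_singleton_iff] at ht
      exact ⟨0, fun x _ _ => by simp [ht]⟩
  have hS : ∀ t ∈ QDiff.boundedProducts T γm γp, ∃ C : ℝ, ∀ x, 0 < x →
      (∀ s ∈ Icc γm γp, s * x ∈ I) → F (t * x) = F x + C * x ^ p :=
    fun t ht => QDiff.exists_increment hF h0 h1 h2 ht
  have horb := fun x (hx : x ∈ interior I) =>
    QDiff.exists_nhds_dense_orbit hI hIint h0 h1 h2 hd hS hab hx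
  have hmove : ∀ x ∈ I, ∃ s ∈ QDiff.starSet T, s * x ∈ interior I := by
    obtain ⟨t, ht, ht1, htr⟩ := QDiff.exists_small_factor hT h0 h1 h2 hd
    exact fun x hx => QDiff.exists_factor_mem_interior hI hIint ht ht1 htr hab hx
  obtain ⟨U, hUI, hU, hUn, hUc⟩ := hcont
  obtain ⟨u, hu, v, hv, huv⟩ := hUn.exists_lt
  have hUsub : Ioo u v ⊆ U := Ioo_subset_Icc_self.trans (hU.out hu hv)
  have hcU : ∀ y ∈ Ioo u v, ContinuousAt F y := by
    intro y hy
    have hyI : y ∈ I := hUI (hUsub hy)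
    have hnU : U ∈ 𝓝 y := mem_of_superset (Ioo_mem_nhds hy.1 hy.2) hUsub
    have hφc : ContinuousAt φ ⟨y, hyI⟩ :=
      hUc.continuousAt (continuous_subtype_val.continuousAt.preimage_mem_nhds hnU)
    have hnI : I ∈ 𝓝 y := mem_of_superset hnU hUI
    rw [ContinuousAt, ← map_nhds_subtype_coe_eq_nhds hyI hnI, tendsto_map'_iff,
      show F ∘ ((↑) : I → ℝ) = φ from funext hFφ, hFφ ⟨y, hyI⟩]
    exact hφc
  have hmid : (u + v) / 2 ∈ Ioo u v := ⟨by linarith, by linarith⟩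
  have hmidI : (u + v) / 2 ∈ interior I :=
    QDiff.Ioo_subset_interior hIint (hUI hu) (hUI hv) hmid
  have hcI : ∀ x ∈ interior I, ContinuousAt F x := fun x hx =>
    (QDiff.forall_of_locallyShiftsBy (P := fun x => ∀ᶠ y in 𝓝 x, ContinuousAt F y) hIint horb
      (fun x hx => eventually_eventually_nhds.2 hx)
      (fun x hx r _ hs hP => QDiff.eventually_continuousAt_of_locallyShiftsBy
        (hI (interior_subset hx)) hs hP) hmidI
      (mem_of_superset (Ioo_mem_nhds hmid.1 hmid.2) hcU) x hx).self_of_nhds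
  obtain ⟨t, -, q, -, hq, -, hq1, hq2, a, b, ha, hb, hIab⟩ :=
    QDiff.exists_base_point hI hIint h0 h1 h2 hd hab hmidI
  have hqI : q ∈ interior I := hIab ⟨by nlinarith, by nlinarith⟩
  have hlocal := QDiff.exists_local_form h1 h2 QDiff.boundedProducts_subset_Icc hd hS hcI hq
    ha hb hIab
  constructor
  · intro hp
    obtain ⟨a, b, hab⟩ := QDiff.exists_form (h := fun x => x ^ p) (κ := fun r => r ^ p - 1)
      (m := 1) (n := 0) hI hIint hT hF hmove horb
      (fun x hx y hy hxy => (Real.rpow_left_inj (le_of_lt hx) (le_of_lt hy) hp).1 hxy)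
      (fun r w hr hw => by simp only [Real.mul_rpow hr.le hw.le]; ring) (fun w _ => by simp)
      hqI (hlocal.1 hp)
    exact ⟨a, b, fun x => by rw [← hFφ, hab x x.2]⟩
  -- For `p = 0` the constant function `x ^ p = 1` lies in the family `a * log x + b`.
  · intro hp
    obtain ⟨a, b, hab⟩ := QDiff.exists_form (h := Real.log) (κ := Real.log)
      (m := 0) (n := 1) hI hIint hT hF hmove horb Real.log_injOn_pos
      (fun r w hr hw => by rw [Real.log_mul hr.ne' hw.ne', hp]; simp; ring) (fun w _ => by simp [hp])
      hqI (hlocal.2 hp)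
    exact ⟨a, b, fun x => by rw [← hFφ, hab x x.2]⟩
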